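/- **Theorem 5.6** (The quantum computer made of quantum dots is universal). Fix $\hbar>0$. For an array of $n$ quantum dots, each carrying a qubit with basis $|0\rangle$ (spin up), $|1\rangle$ (spin down), consider the Hamiltonian on $(\mathbb C^2)^{\otimes n}$ $$H(t)=\frac\hbar2\Big[\sum_{j=1}^n \boldsymbol\Omega_j(t)\cdot \mathbf S_j+\sum_{1\le j<k\le n}\omega_{jk}(t)\,\mathbf S_j\cdot\mathbf S_k\Big],$$ where $\mathbf S_j=(\sigma_x,\sigma_y,\sigma_z)$ are the Pauli matrices acting on the $j$-th qubit, and the control pulses $\boldsymbol\Omega_j:\mathbb R\to\mathbb R^3$ and $\omega_{jk}:\mathbb R\to[0,\infty)$ are continuous. A *pulse gate* of the array is an operator $U(T)$, $T>0$, where $U(0)=\mathbf 1$ and $i\hbar\,U'(t)=H(t)U(t)$ on $[0,T]$, for control pulses of which at most one (a single $\boldsymbol\Omega_j$ or a single $\omega_{jk}$) is not identically zero. For a 1-bit operator $A$ and a 2-bit operator $B$, let $A(\ell)$ and $B(\ell,m)$, $\ell\ne m$, denote their action on the qubit $\ell$, respectively on the qubits $\ell,m$ in this order, of an $n$-qubit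 system. Then: 1. For all $\theta,\phi\in[0,2\pi]$ the rotation gate $$U_{\theta,\phi}=\begin{pmatrix}\cos\theta&-ie^{-i\phi}\sin\theta\\-ie^{i\phi}\sin\theta&\cos\theta\end{pmatrix}$$ is a pulse gate of a single dot, and $U_{\theta,\phi}(1)$, $U_{\theta,\phi}(2)$ are pulse gates of the array of two dots. 2. The phase gate $Q_\pi=\operatorname{diag}(1,1,1,-1)$ is, up to a phase factor (a scalar of modulus one), a finite composition of pulse gates of two dots. 3. So is the CNOT gate, given by $|0y\rangle\mapsto|0y\rangle$ and $|1y\rangle\mapsto|1\rangle\otimes\sigma_x|y\rangle$. 4. The collection of all pulse gates of one dot and all pulse gates of two dots is universal: for each $n\ge2$, every $n$-bit gate (unitary operator on $(\mathbb C^2)^{\otimes n}$) is, up to a phase factor, exactly a finite composition of operators $A(\ell)$ and $B(\ell,m)$, $1\le\ell,m\le n$, $\ell\ne m$, with $A$ a pulse gate of one dot and $B$ a pulse gate of two dots. 5. For each $n\ge2$, every $n$-bit gate is, up to a phase factor, exactly a finite composition of pulse gates of the array of $n$ dots. -/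

import Mathlib

namespace QDot

open Matrix Complex

/-- Operators on `n` qubits, as matrices in the basis of kets `|x_0 x_1 … x_{n-1}⟩`
with `x : Fin n → Fin 2`; the entry `M x y` is `⟨x| M |y⟩`. -/
abbrev Op (n : ℕ) : Type := Matrix (Fin n → Fin 2) (Fin n → Fin 2) ℂ

/-- The operator `A(j)`: the one-qubit operator `A` acting on slot `j` of `n` qubits. -/
def onQubit {n : ℕ} (j : Fin n) (A : Matrix (Fin 2) (Fin 2) ℂ) : Op n :=
  Matrix.of fun x y => if ∀ i, i ≠ j → x i = y i then A (x j) (y j) else 0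

/-- The operator `B(j,k)`: the two-qubit operator `B` acting on the slots `j`, `k` (in this
order) of `n` qubits. Only used for `j ≠ k`. -/
def onPair {n : ℕ} (j k : Fin n) (B : Op 2) : Op n :=
  Matrix.of fun x y =>
    if ∀ i, i ≠ j → i ≠ k → x i = y i then B ![x j, x k] ![y j, y k] else 0

/-- The Pauli matrices `σ_x, σ_y, σ_z`, indexed by `0, 1, 2`. -/
def pauli : Fin 3 → Matrix (Fin 2) (Fin 2) ℂ :=
  ![!![0, 1; 1, 0], !![0, -I; I, 0], !![1, 0; 0, -1]]

/-- The rotation gate `U_{θ,φ}`. -/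
noncomputable def rotGate (θ φ : ℝ) : Matrix (Fin 2) (Fin 2) ℂ :=
  !![(Real.cos θ : ℂ), -I * exp (-I * φ) * Real.sin θ;
     -I * exp (I * φ) * Real.sin θ, (Real.cos θ : ℂ)]

/-- The quantum phase gate `Q_η = diag(1, 1, 1, e^{iη})`. -/
noncomputable def phaseGate (η : ℝ) : Op 2 :=
  Matrix.diagonal fun x => if x 0 = 1 ∧ x 1 = 1 then exp (I * η) else 1

/-- The controlled gate `Λ₁(A)`; slot `0` is the control, slot `1` the target. -/
def controlled (A : Matrix (Fin 2) (Fin 2) ℂ) : Op 2 :=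
  Matrix.of fun x y =>
    if x 0 = y 0 then
      if x 0 = 1 then A (x 1) (y 1) else if x 1 = y 1 then 1 else 0
    else 0

/-- The controlled-not gate `Λ₁(σ_x)`. -/
def cnot : Op 2 := controlled (pauli 0)

/-- Control pulses of an array of `n` quantum dots. `Ω j t` is the rescaled magnetic pulse at
dot `j`, that is `μ_B g_j(t) B_j(t) = (ħ/2) Ω_j(t)`; for `j < k`, `ω j k t` is the rescaled
exchange coupling of the dots `j` and `k`, that is `J_{jk}(t) = (ħ/2) ω_{jk}(t)`. Since
`J_{jk} = 4 t_{jk}² / u` (with `t_{jk}` the real tunneling matrix element and `u > 0` the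
charging energy), the couplings are nonnegative. -/
structure Pulses (n : ℕ) where
  Ω : Fin n → ℝ → Fin 3 → ℝ
  ω : Fin n → Fin n → ℝ → ℝ
  continuous_Ω : ∀ j, Continuous (Ω j)
  continuous_ω : ∀ j k, Continuous (ω j k)
  ω_nonneg : ∀ j k t, 0 ≤ ω j k t

/-- The Hamiltonian of `n` quantum dots,
`H(t) = (ħ/2) (∑_j Ω_j(t) · S_j + ∑_{j<k} ω_{jk}(t) S_j · S_k)`,
where `S_j = (σ_x, σ_y, σ_z)` acts on dot `j`. -/
noncomputable def hamiltonian (ħ : ℝ) {n : ℕ} (p : Pulses n) (t : ℝ) : Op n :=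
  ((ħ / 2 : ℝ) : ℂ) •
    ((∑ j, ∑ a, (p.Ω j t a : ℂ) • onQubit j (pauli a)) +
      ∑ j, ∑ k ∈ Finset.Ioi j,
        (p.ω j k t : ℂ) • ∑ a, onQubit j (pauli a) * onQubit k (pauli a))

/-- `U` is the time evolution operator on `[0,T]` of the array driven by the pulses `p`:
`U(0) = 1` and `i ħ U'(t) = H(t) U(t)` for `t ∈ [0,T]`. -/
def IsEvolution (ħ : ℝ) {n : ℕ} (p : Pulses n) (T : ℝ) (U : ℝ → Op n) : Prop :=
  U 0 = 1 ∧ ∀ t ∈ Set.Icc 0 T, ∀ x y,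
    HasDerivWithinAt (fun s => U s x y)
      ((I * ħ)⁻¹ * (hamiltonian ħ p t * U t) x y) (Set.Icc 0 T) t

/-- Only one of the control pulses is ever switched on: either one magnetic pulse `Ω_j`, or one
exchange coupling `ω_{jk}`. -/
def Pulses.IsElementary {n : ℕ} (p : Pulses n) : Prop :=
  (∃ j, (∀ i, i ≠ j → p.Ω i = 0) ∧ p.ω = 0) ∨
    (p.Ω = 0 ∧ ∃ j k, j < k ∧ ∀ i l, (i, l) ≠ (j, k) → p.ω i l = 0)

/-- The elementary gates of an array of `n` quantum dots: the operators `U(T)`, `T > 0`, for the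
evolution under pulses of which only one is switched on. -/
def pulseGates (ħ : ℝ) (n : ℕ) : Set (Op n) :=
  {G | ∃ (p : Pulses n) (T : ℝ) (U : ℝ → Op n),
    p.IsElementary ∧ 0 < T ∧ IsEvolution ħ p T U ∧ U T = G}

/-- The elementary one-bit gates: those of a single dot. -/
def oneDotGates (ħ : ℝ) : Set (Matrix (Fin 2) (Fin 2) ℂ) :=
  {A | onQubit (0 : Fin 1) A ∈ pulseGates ħ 1}

/-- The finite compositions of gates `A(l)`, `A ∈ S₁`, and `B(l,m)`, `B ∈ S₂`, `l ≠ m`, on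
`n` qubits. -/
def circuits (S₁ : Set (Matrix (Fin 2) (Fin 2) ℂ)) (S₂ : Set (Op 2)) (n : ℕ) :
    Submonoid (Op n) :=
  Submonoid.closure
    ({G | ∃ l, ∃ A ∈ S₁, G = onQubit l A} ∪ {G | ∃ l m, l ≠ m ∧ ∃ B ∈ S₂, G = onPair l m B})

/-- `G` belongs to `M` up to a phase factor. -/
def MemUpToPhase {n : ℕ} (G : Op n) (M : Submonoid (Op n)) : Prop :=
  ∃ c : ℂ, ‖c‖ = 1 ∧ c • G ∈ M

/-- A collection of one-bit gates `S₁` and two-bit gates `S₂` is universal: for each `n ≥ 2`,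
every `n`-bit gate (unitary operator on `n` qubits) is, up to a phase factor, exactly a finite
composition of gates `A(l)` and `B(l,m)` from the collection. -/
def Universal (S₁ : Set (Matrix (Fin 2) (Fin 2) ℂ)) (S₂ : Set (Op 2)) : Prop :=
  ∀ n : ℕ, 2 ≤ n → ∀ G ∈ Matrix.unitaryGroup (Fin n → Fin 2) ℂ,
    MemUpToPhase G (circuits S₁ S₂ n)

end QDot

namespace QDot
open Matrix Complex

/-! ### Gates generated by constant pulses -/

/-! Constant pulses already suffice. If `K * K = 1`, the Hamiltonian `ħ (α + c K)` generates a phase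
times `cos (c t) - i sin (c t) K`. A magnetic pulse thus yields every spin rotation, among them
`rotGate θ φ` with axis `(cos φ, sin φ, 0)`. A coupling yields the gates `exchangeGate w`, because
`S_j · S_k = 2 SWAP - 1`.

The rest concerns any submonoid `N` containing the phases, the rotations and the exchange gates
(`HasDotGates`). The functions `g` with all `exp (i s g)` in `N` form a real vector space. It
contains `1`, the signs `z_j` and, by a spin-echo product of two exchange gates, `z_j z_k`. Hence
`N` contains controlled-Z and, after Hadamard conjugation, CNOT. Composition with CNOT produces all
products of the `z_j`, which are the characters of `(ℤ/2)^n` and span all functions. So `N` contains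
every diagonal unitary (`diagonal_mem`).

Hadamard conjugation of diagonal gates gives the rotations in the plane of two kets differing in one
bit, then the transpositions of such kets. Connectedness of the hypercube gives all transpositions,
hence all plane rotations. Givens elimination (`unitaryGroup_le_of_planeRotation_mem`) concludes. -/

lemma sum_ite_agree_off {n : ℕ} (j : Fin n) (x : Fin n → Fin 2) (f : (Fin n → Fin 2) → ℂ) :
    (∑ z, if ∀ i, i ≠ j → x i = z i then f z else 0) = ∑ b, f (Function.update x j b) := by
  rw [← Finset.sum_filter]
  have : (Finset.univ.filter fun z : Fin n → Fin 2 => ∀ i, i ≠ j → x i = z i) =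
      Finset.univ.image (Function.update x j) := by
    ext z
    simp only [Finset.mem_filter, Finset.mem_univ, true_and, Finset.mem_image]
    constructor
    · intro h
      refine ⟨z j, ?_⟩
      ext1 i
      by_cases hi : i = j
      · subst hi; simp
      · simp [hi, h i hi]
    · rintro ⟨b, rfl⟩ i hi
      simp [hi]
  rw [this, Finset.sum_image]
  intro a _ b _ h
  exact Function.update_injective x j h

/-- The operator acting on slot `j` by a matrix that depends on the other slots. -/
def multiplexed {n : ℕ} (j : Fin n) (F : (Fin n → Fin 2) → Matrix (Fin 2) (Fin 2) ℂ) : Op n :=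
  Matrix.of fun x y =>
    if ∀ i, i ≠ j → x i = y i then F (Function.update x j 0) (x j) (y j) else 0

lemma onQubit_eq_multiplexed {n : ℕ} (j : Fin n) (A : Matrix (Fin 2) (Fin 2) ℂ) :
    onQubit j A = multiplexed j fun _ => A := rfl

lemma multiplexed_mul_apply {n : ℕ} (j : Fin n) (F : (Fin n → Fin 2) → Matrix (Fin 2) (Fin 2) ℂ)
    (M : Op n) (x y : Fin n → Fin 2) :
    (multiplexed j F * M) x y =
      ∑ b, F (Function.update x j 0) (x j) b * M (Function.update x j b) y := by
  rw [Matrix.mul_apply]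
  have := sum_ite_agree_off j x fun z => F (Function.update x j 0) (x j) (z j) * M z y
  simp only [Function.update_self] at this
  rw [← this]
  refine Finset.sum_congr rfl fun z _ => ?_
  simp [multiplexed, ite_mul]

/-- Such operators are block diagonal with one 2 × 2 block for each setting of the other slots.
Resetting slot `j` to `0` in the argument of `F` keeps the block independent of that slot. -/
lemma multiplexed_mul {n : ℕ} (j : Fin n) (F G : (Fin n → Fin 2) → Matrix (Fin 2) (Fin 2) ℂ) :
    multiplexed j F * multiplexed j G = multiplexed j fun x => F x * G x := by
  ext x y
  rw [multiplexed_mul_apply]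
  have h : ∀ b, (∀ i, i ≠ j → Function.update x j b i = y i) ↔ ∀ i, i ≠ j → x i = y i := by
    intro b
    refine forall_congr' fun i => forall_congr' fun hi => ?_
    simp [hi]
  simp only [multiplexed, Matrix.of_apply, h, Function.update_idem, Function.update_self,
    Matrix.mul_apply]
  split_ifs <;> simp

lemma diagonal_eq_multiplexed {n : ℕ} (j : Fin n) (f : (Fin n → Fin 2) → ℂ) :
    Matrix.diagonal f =
      multiplexed j fun x => Matrix.diagonal fun b => f (Function.update x j b) := by
  ext x y
  simp only [multiplexed, Matrix.of_apply, Matrix.diagonal_apply, Function.update_idem,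
    Function.update_eq_self]
  by_cases h : x = y
  · simp [h]
  · rw [if_neg h]
    split_ifs with h1 h2
    · exact absurd (funext fun i => if hi : i = j then hi ▸ h2 else h1 i hi) h
    · rfl
    · rfl

lemma onQubit_mul {n : ℕ} (j : Fin n) (A B : Matrix (Fin 2) (Fin 2) ℂ) :
    onQubit j A * onQubit j B = onQubit j (A * B) := by
  simp only [onQubit_eq_multiplexed, multiplexed_mul]

lemma onQubit_add {n : ℕ} (j : Fin n) (A B : Matrix (Fin 2) (Fin 2) ℂ) :
    onQubit j (A + B) = onQubit j A + onQubit j B := by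
  ext x y; simp [onQubit]; split_ifs <;> simp

lemma onQubit_smul {n : ℕ} (j : Fin n) (c : ℂ) (A : Matrix (Fin 2) (Fin 2) ℂ) :
    onQubit j (c • A) = c • onQubit j A := by
  ext x y; simp [onQubit]

lemma onQubit_one {n : ℕ} (j : Fin n) : onQubit j 1 = (1 : Op n) := by
  rw [← Matrix.diagonal_one (n := Fin n → Fin 2), diagonal_eq_multiplexed j]
  simp [onQubit_eq_multiplexed]

/-! ### Two-qubit operators, the exchange of qubits and the Heisenberg coupling. -/

lemma onQubit_mul_onQubit_apply {n : ℕ} {j k : Fin n} (hjk : j ≠ k)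
    (A B : Matrix (Fin 2) (Fin 2) ℂ) (x y : Fin n → Fin 2) :
    (onQubit j A * onQubit k B) x y =
      if ∀ i, i ≠ j → i ≠ k → x i = y i then A (x j) (y j) * B (x k) (y k) else 0 := by
  rw [onQubit_eq_multiplexed, multiplexed_mul_apply]
  have h : ∀ b, (∀ i, i ≠ k → Function.update x j b i = y i) ↔
      (∀ i, i ≠ j → i ≠ k → x i = y i) ∧ b = y j := by
    intro b
    constructor
    · intro h
      refine ⟨fun i hi hk => ?_, by simpa using h j hjk⟩
      simpa [hi] using h i hk
    · rintro ⟨h, rfl⟩ i hi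
      by_cases hij : i = j
      · subst hij; simp
      · simpa [hij] using h i hij hi
  simp only [onQubit, Matrix.of_apply, h, Function.update_of_ne hjk.symm]
  split_ifs with h0
  · rw [Finset.sum_eq_single (y j)]
    · rw [if_pos ⟨h0, rfl⟩]
    · intro b _ hb; simp [hb]
    · simp
  · simp [h0]

/-- The operator exchanging two qubits. -/
def swapGate : Op 2 := Matrix.of fun x y => if x 0 = y 1 ∧ x 1 = y 0 then 1 else 0

lemma onPair_add {n : ℕ} (j k : Fin n) (A B : Op 2) :
    onPair j k (A + B) = onPair j k A + onPair j k B := by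
  ext x y; simp [onPair]; split_ifs <;> simp

lemma onPair_smul {n : ℕ} (j k : Fin n) (c : ℂ) (A : Op 2) :
    onPair j k (c • A) = c • onPair j k A := by
  ext x y; simp [onPair]

lemma onPair_one {n : ℕ} (j k : Fin n) : onPair j k 1 = (1 : Op n) := by
  ext x y
  simp only [onPair, Matrix.of_apply, Matrix.one_apply]
  by_cases h : x = y
  · simp [h]
  · rw [if_neg h]
    split_ifs with h1 h2
    · refine absurd (funext fun i => ?_) h
      by_cases hj : i = j
      · subst hj; simpa using congrFun h2 0
      · by_cases hk : i = k
        · subst hk; simpa using congrFun h2 1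
        · exact h1 i hj hk
    · rfl
    · rfl

lemma onPair_zero_one (B : Op 2) : onPair 0 1 B = B := by
  ext x y
  have h : ∀ z : Fin 2 → Fin 2, ![z 0, z 1] = z := fun z => by ext i; fin_cases i <;> rfl
  simp only [onPair, Matrix.of_apply, h]
  rw [if_pos]
  intro i; fin_cases i <;> simp

/-- The permutation of the basis kets which exchanges the qubits `j` and `k`. -/
def exchange {n : ℕ} (j k : Fin n) : Equiv.Perm (Fin n → Fin 2) :=
  Equiv.arrowCongr (Equiv.swap j k) (Equiv.refl (Fin 2))

lemma exchange_apply {n : ℕ} (j k : Fin n) (x : Fin n → Fin 2) (i : Fin n) :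
    exchange j k x i = x (Equiv.swap j k i) := by
  simp [exchange]

lemma onPair_swapGate {n : ℕ} (j k : Fin n) :
    onPair j k swapGate = (exchange j k).permMatrix ℂ := by
  ext x y
  simp only [onPair, swapGate, Matrix.of_apply, Equiv.Perm.permMatrix, PEquiv.toMatrix_apply]
  have : y ∈ (exchange j k).toPEquiv x ↔
      (∀ i, i ≠ j → i ≠ k → x i = y i) ∧ x j = y k ∧ x k = y j := by
    rw [Equiv.toPEquiv_apply, Option.mem_some_iff]
    constructor
    · rintro rfl
      refine ⟨fun i hj hk => ?_, ?_, ?_⟩ <;>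
        simp [exchange_apply, Equiv.swap_apply_of_ne_of_ne, *]
    · rintro ⟨h1, h2, h3⟩
      ext1 i
      rw [exchange_apply]
      by_cases hj : i = j
      · subst hj; simp [h3]
      · by_cases hk : i = k
        · subst hk; simp [h2]
        · rw [Equiv.swap_apply_of_ne_of_ne hj hk, h1 i hj hk]
  simp only [this, ← ite_and]
  simp

lemma onPair_swapGate_mul_self {n : ℕ} (j k : Fin n) :
    onPair j k swapGate * onPair j k swapGate = (1 : Op n) := by
  have : exchange j k * exchange j k = 1 := by
    ext x i; simp [exchange_apply]
  rw [onPair_swapGate, ← Matrix.permMatrix_mul, this, Matrix.permMatrix_one]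

lemma pauli_zero : pauli 0 = !![0, 1; 1, 0] := rfl

lemma pauli_one : pauli 1 = !![0, -I; I, 0] := rfl

lemma pauli_two : pauli 2 = !![1, 0; 0, -1] := rfl

/-- This rewrites the coupling through an involution, so that `involutionFlow` applies. Only the
four bits in slots `j`, `k` of the two kets matter, which leaves sixteen cases. -/
lemma sum_pauli_mul_pauli {n : ℕ} {j k : Fin n} (hjk : j ≠ k) :
    ∑ a, onQubit j (pauli a) * onQubit k (pauli a) =
      (2 : ℂ) • onPair j k swapGate - (1 : Op n) := by
  rw [← onPair_one j k]
  ext x y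
  simp only [Matrix.sum_apply, onQubit_mul_onQubit_apply hjk, Matrix.sub_apply, Matrix.smul_apply,
    onPair, Matrix.of_apply]
  split_ifs with h
  · generalize x j = a, x k = b, y j = c, y k = d
    revert a b c d
    simp only [Fin.forall_fin_two]
    norm_num [Fin.sum_univ_three, pauli_zero, pauli_one, pauli_two, swapGate, Matrix.one_apply]
  · simp

/-- The time evolution generated by a constant Hamiltonian `ħ (α + c K)` with `K ^ 2 = 1`. -/
noncomputable def involutionFlow {n : ℕ} (α c : ℝ) (K : Op n) (t : ℝ) : Op n :=
  exp (-I * α * t) • (cos (c * t) • (1 : Op n) + (-I * sin (c * t)) • K)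

/-- Euler's formula holds with `K` in place of a real sign, since `K * K = 1`; differentiation in
`t` then multiplies by `-i (α + c K)`. -/
lemma isEvolution_involutionFlow {ħ : ℝ} (hħ : 0 < ħ) {n : ℕ} {p : Pulses n} {α c : ℝ} {K : Op n}
    (hK : K * K = 1) (hp : ∀ t, hamiltonian ħ p t = (ħ : ℂ) • ((α : ℂ) • (1 : Op n) + (c : ℂ) • K))
    (T : ℝ) : IsEvolution ħ p T (involutionFlow α c K) := by
  have hħ' : (ħ : ℂ) ≠ 0 := by exact_mod_cast hħ.ne'
  refine ⟨by simp [involutionFlow], fun t _ x y => HasDerivAt.hasDerivWithinAt ?_⟩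
  have ht : HasDerivAt (fun s : ℝ => (s : ℂ)) 1 t := Complex.ofRealCLM.hasDerivAt
  have h1 : HasDerivAt (fun s : ℝ => exp (-I * α * s)) (exp (-I * α * t) * (-I * α * 1)) t :=
    (ht.const_mul (-I * α)).cexp
  have h2 : HasDerivAt (fun s : ℝ => cos (c * s)) (-sin (c * t) * (c * 1)) t :=
    HasDerivAt.comp t (Complex.hasDerivAt_cos _) (ht.const_mul (c : ℂ))
  have h3 : HasDerivAt (fun s : ℝ => sin (c * s)) (cos (c * t) * (c * 1)) t :=
    HasDerivAt.comp t (Complex.hasDerivAt_sin _) (ht.const_mul (c : ℂ))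
  have key := h1.mul ((h2.mul_const ((1 : Op n) x y)).add ((h3.const_mul (-I)).mul_const (K x y)))
  have hU : (I * ħ)⁻¹ * (hamiltonian ħ p t * involutionFlow α c K t) x y =
      -I * exp (-I * α * t) * (α * (cos (c * t) * (1 : Op n) x y + -I * sin (c * t) * K x y) +
        c * (cos (c * t) * K x y + -I * sin (c * t) * (1 : Op n) x y)) := by
    have hi : (I * ħ)⁻¹ = -I * (ħ : ℂ)⁻¹ := by rw [mul_inv, Complex.inv_I]
    have e : ((α : ℂ) • (1 : Op n) + (c : ℂ) • K) * (cos (c * t) • (1 : Op n) +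
        (-I * sin (c * t)) • K) = (α : ℂ) • (cos (c * t) • (1 : Op n) + (-I * sin (c * t)) • K) +
          (c : ℂ) • (cos (c * t) • K + (-I * sin (c * t)) • (1 : Op n)) := by
      simp only [add_mul, mul_add, smul_mul_assoc, mul_smul_comm, one_mul, mul_one, hK]
      module
    rw [hp, involutionFlow, smul_mul_assoc, mul_smul_comm, e, hi]
    simp only [Matrix.smul_apply, Matrix.add_apply, smul_eq_mul]
    field_simp
  rw [hU]
  refine (key.congr_deriv ?_).congr_of_eventuallyEq (Filter.Eventually.of_forall fun s => ?_)
  · simp only [Pi.add_apply]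
    linear_combination (-(c : ℂ) * exp (-I * α * t) * sin (c * t) * (1 : Op n) x y) * I_mul_I
  · simp [involutionFlow]

/-- The rotation of a spin by the angle `2c` about the axis `v`. -/
noncomputable def spinRotation (c : ℝ) (v : Fin 3 → ℝ) : Matrix (Fin 2) (Fin 2) ℂ :=
  cos c • (1 : Matrix (Fin 2) (Fin 2) ℂ) + (-I * sin c) • ∑ a, (v a : ℂ) • pauli a

lemma sum_smul_pauli_mul_self {v : Fin 3 → ℝ} (hv : ∑ a, v a ^ 2 = 1) :
    (∑ a, (v a : ℂ) • pauli a) * (∑ a, (v a : ℂ) • pauli a) = 1 := by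
  have h : (v 0 : ℂ) ^ 2 + (v 1 : ℂ) ^ 2 + (v 2 : ℂ) ^ 2 = 1 := by
    rw [Fin.sum_univ_three] at hv; exact_mod_cast hv
  ext a b
  fin_cases a <;> fin_cases b <;>
    simp [Fin.sum_univ_three, pauli, Matrix.mul_apply, Fin.sum_univ_two] <;>
    first
    | linear_combination h - (v 1 : ℂ) ^ 2 * I_mul_I
    | ring

lemma onQubit_sum {n : ℕ} (j : Fin n) (A : Fin 3 → Matrix (Fin 2) (Fin 2) ℂ) :
    onQubit j (∑ a, A a) = ∑ a, onQubit j (A a) := by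
  simp [Fin.sum_univ_three, onQubit_add]

lemma onQubit_spinRotation_mem_pulseGates {ħ : ℝ} (hħ : 0 < ħ) {n : ℕ} (j : Fin n) (c : ℝ)
    {v : Fin 3 → ℝ} (hv : ∑ a, v a ^ 2 = 1) :
    onQubit j (spinRotation c v) ∈ pulseGates ħ n := by
  let p : Pulses n :=
    -- The factor `2` cancels the one in `ħ / 2`, so the Hamiltonian is `ħ c K` with `K = v · σ` on
    -- slot `j`.
    { Ω := Pi.single j fun _ a => 2 * c * v a
      ω := 0
      continuous_Ω := fun i => by
        by_cases h : i = j
        · subst h; simpa using continuous_const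
        · simpa [h] using (continuous_zero (X := ℝ))
      continuous_ω := fun i k => continuous_const
      ω_nonneg := fun i k t => le_rfl }
  refine ⟨p, 1, involutionFlow 0 c (onQubit j (∑ a, (v a : ℂ) • pauli a)),
    Or.inl ⟨j, fun i hi => by simp [p, hi], rfl⟩, one_pos,
    isEvolution_involutionFlow hħ ?_ (fun t => ?_) 1, ?_⟩
  · rw [onQubit_mul, sum_smul_pauli_mul_self hv, onQubit_one]
  · have : ∑ i, ∑ a, (p.Ω i t a : ℂ) • onQubit i (pauli a) =
        ∑ a, ((2 * c * v a : ℝ) : ℂ) • onQubit j (pauli a) := by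
      rw [Finset.sum_eq_single j]
      · simp [p]
      · intro i _ hi; simp [p, hi]
      · simp
    rw [hamiltonian, this]
    simp only [onQubit_sum, onQubit_smul, Finset.smul_sum, p, Pi.zero_apply]
    simp only [Fin.sum_univ_three]
    push_cast
    simp
    module
  · rw [spinRotation, onQubit_add, onQubit_smul, onQubit_smul, onQubit_one]
    simp [involutionFlow]

/-- The gate obtained by switching on the exchange coupling of two dots. -/
noncomputable def exchangeGate (w : ℝ) : Op 2 :=
  exp (I * (w / 2)) • (cos w • (1 : Op 2) + (-I * sin w) • swapGate)

lemma onPair_exchangeGate {n : ℕ} (j k : Fin n) (w : ℝ) :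
    onPair j k (exchangeGate w) =
      exp (I * (w / 2)) • (cos w • (1 : Op n) + (-I * sin w) • onPair j k swapGate) := by
  simp only [exchangeGate, onPair_smul, onPair_add, onPair_one]

lemma onPair_exchangeGate_mem_pulseGates {ħ : ℝ} (hħ : 0 < ħ) {n : ℕ} {j k : Fin n} (hjk : j < k)
    {w : ℝ} (hw : 0 ≤ w) : onPair j k (exchangeGate w) ∈ pulseGates ħ n := by
  let p : Pulses n :=
    { Ω := 0
      ω := fun i l _ => if (i, l) = (j, k) then w else 0
      continuous_Ω := fun i => continuous_const
      continuous_ω := fun i k => continuous_const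
      ω_nonneg := fun i k t => by split_ifs <;> [exact hw; exact le_rfl] }
  -- Here `(ħ / 2) w (2 SWAP - 1) = ħ (-w / 2 + w SWAP)`.
  refine ⟨p, 1, involutionFlow (-(w / 2)) w (onPair j k swapGate),
    Or.inr ⟨rfl, j, k, hjk, fun i l h => by ext t; simp only [p, if_neg h, Pi.zero_apply]⟩, one_pos,
    isEvolution_involutionFlow hħ (onPair_swapGate_mul_self j k) (fun t => ?_) 1, ?_⟩
  · have : ∑ i, ∑ l ∈ Finset.Ioi i, (p.ω i l t : ℂ) •
        ∑ a, onQubit i (pauli a) * onQubit l (pauli a) =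
          (w : ℂ) • ((2 : ℂ) • onPair j k swapGate - (1 : Op n)) := by
      rw [Finset.sum_eq_single j, Finset.sum_eq_single k]
      · simp [p, sum_pauli_mul_pauli hjk.ne]
      · intro l _ hl; simp [p, hl]
      · intro h; exact absurd (Finset.mem_Ioi.2 hjk) h
      · intro i _ hi; simp [p, hi]
      · simp
    rw [hamiltonian, this]
    simp only [p, Pi.zero_apply, Complex.ofReal_zero, zero_smul, Finset.sum_const_zero, zero_add]
    push_cast
    module
  · rw [onPair_exchangeGate]
    simp [involutionFlow]

end QDot
namespace QDot
open Matrix Complex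

/-! ### Generation of the unitary group by diagonal matrices and plane rotations -/

/-- The rotation `cos θ - i sin θ σ_x` in the coordinate plane of `p` and `q`. -/
noncomputable def planeRotation {ι : Type*} [DecidableEq ι] (p q : ι) (θ : ℝ) : Matrix ι ι ℂ :=
  Matrix.of fun x y =>
    if x = y then if x = p ∨ x = q then cos θ else 1
    else if x = p ∧ y = q ∨ x = q ∧ y = p then -I * sin θ else 0

lemma planeRotation_submatrix {ι : Type*} [DecidableEq ι] (p q : ι) (θ : ℝ) (σ : Equiv.Perm ι) :
    (planeRotation (σ p) (σ q) θ).submatrix σ σ = planeRotation p q θ := by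
  ext x y
  simp [planeRotation]

variable {ι : Type*} [Fintype ι] [DecidableEq ι]

lemma planeRotation_mulVec {p q : ι} (hpq : p ≠ q) (θ : ℝ) (v : ι → ℂ) :
    planeRotation p q θ *ᵥ v = fun x =>
      if x = p then cos θ * v p - I * sin θ * v q
      else if x = q then cos θ * v q - I * sin θ * v p else v x := by
  ext x
  rw [Matrix.mulVec, dotProduct]
  split_ifs with h1 h2
  · subst h1
    rw [Fintype.sum_eq_add x q hpq fun z hz => by simp [planeRotation, hz.1.symm, hz.2, hpq]]
    simp [planeRotation, hpq]
    ring
  · subst h2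
    rw [Fintype.sum_eq_add x p hpq.symm fun z hz => by
      simp [planeRotation, hz.1.symm, hz.2, hpq.symm]]
    simp [planeRotation, hpq.symm]
    ring
  · rw [Fintype.sum_eq_single x fun z hz => by simp [planeRotation, hz.symm, h1, h2]]
    simp [planeRotation, h1, h2]

lemma planeRotation_mem_unitaryGroup {p q : ι} (hpq : p ≠ q) (θ : ℝ) :
    planeRotation p q θ ∈ unitaryGroup ι ℂ := by
  rw [Matrix.mem_unitaryGroup_iff]
  have hstar : star (planeRotation p q θ) = planeRotation p q (-θ) := by
    ext x y
    simp only [Matrix.star_apply, planeRotation, Matrix.of_apply]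
    by_cases h : x = y
    · subst h
      simp only [if_true]
      split_ifs <;> simp [← Complex.ofReal_cos]
    · have h' : ¬ y = x := fun e => h e.symm
      simp only [if_neg h, if_neg h']
      have : (y = p ∧ x = q ∨ y = q ∧ x = p) ↔ (x = p ∧ y = q ∨ x = q ∧ y = p) := by tauto
      simp only [this]
      split_ifs <;> simp [← Complex.ofReal_sin]
  rw [hstar]
  refine Matrix.ext_of_mulVec_single fun i => ?_
  rw [← Matrix.mulVec_mulVec, planeRotation_mulVec hpq, planeRotation_mulVec hpq]
  have hcs := Complex.cos_sq_add_sin_sq (θ : ℂ)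
  ext x
  simp only [hpq.symm, if_true, if_false, Complex.ofReal_neg, Complex.cos_neg, Complex.sin_neg,
    Matrix.one_mulVec]
  split_ifs with h1 h2
  · subst h1
    linear_combination (Pi.single i (1 : ℂ) : ι → ℂ) x * (hcs - sin θ ^ 2 * I_mul_I)
  · subst h2
    linear_combination (Pi.single i (1 : ℂ) : ι → ℂ) x * (hcs - sin θ ^ 2 * I_mul_I)
  · rfl

lemma diagonal_mem_unitaryGroup {f : ι → ℂ} (hf : ∀ i, ‖f i‖ = 1) :
    diagonal f ∈ unitaryGroup ι ℂ := by
  rw [Matrix.mem_unitaryGroup_iff, Matrix.star_eq_conjTranspose, Matrix.diagonal_conjTranspose,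
    Matrix.diagonal_mul_diagonal, ← Matrix.diagonal_one]
  congr 1
  ext i
  simp [Complex.mul_conj, Complex.normSq_eq_norm_sq, hf i]

/-- `N` need not be closed under inverses, so `W` is built to carry `e_a` to `v` rather than to
reduce `v` to `e_a`. Each step of the induction adds one coordinate to the support of `v` by one
plane rotation and one phase. -/
lemma exists_mulVec_single_eq {N : Submonoid (Matrix ι ι ℂ)}
    (hD : ∀ f : ι → ℂ, (∀ i, ‖f i‖ = 1) → diagonal f ∈ N)
    (hR : ∀ p q : ι, p ≠ q → ∀ θ, planeRotation p q θ ∈ N) (a : ι) (S : Finset ι) (ha : a ∉ S) :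
    ∀ v : ι → ℂ, (∀ i, i ∉ insert a S → v i = 0) →
      ∃ W ∈ N ⊓ unitaryGroup ι ℂ, ∃ r : ℝ, 0 ≤ r ∧ W *ᵥ Pi.single a (r : ℂ) = v ∧
        ∀ i, i ∉ insert a S → W *ᵥ Pi.single i 1 = Pi.single i 1 := by
  have hphase : ∀ z : ℂ, ∃ u : ℂ, ‖u‖ = 1 ∧ u * ‖z‖ = z := fun z =>
    ⟨exp (z.arg * I), Complex.norm_exp_ofReal_mul_I _, by
      rw [mul_comm]; exact Complex.norm_mul_exp_arg_mul_I z⟩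
  have hDu : ∀ (b : ι) (u : ℂ), ‖u‖ = 1 →
      diagonal (Function.update 1 b u) ∈ N ⊓ unitaryGroup ι ℂ := by
    intro b u hu
    have : ∀ i, ‖(Function.update 1 b u : ι → ℂ) i‖ = 1 := by
      intro i
      by_cases hi : i = b
      · subst hi; simpa using hu
      · simp [hi]
    exact ⟨hD _ this, diagonal_mem_unitaryGroup this⟩
  induction S using Finset.induction_on with
  | empty =>
    intro v hv
    obtain ⟨u, hu, huv⟩ := hphase (v a)
    refine ⟨_, hDu a u hu, ‖v a‖, norm_nonneg _, ?_, ?_⟩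
    · ext x
      rw [Matrix.mulVec_diagonal]
      by_cases hx : x = a
      · subst hx; simpa using huv
      · simp [hx, hv x (by simpa using hx)]
    · intro i hi
      have hia : i ≠ a := by simpa using hi
      ext x
      rw [Matrix.mulVec_diagonal]
      by_cases hx : x = i
      · subst hx; simp [hia]
      · simp [hx]
  | insert b S hb ih =>
    intro v hv
    simp only [Finset.mem_insert, not_or] at ha
    obtain ⟨hab, haS⟩ := ha
    obtain ⟨W, hW, r, hr, hWv, hWi⟩ := ih haS (Function.update v b 0) fun i hi => by
      by_cases hib : i = b
      · subst hib; simp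
      · simp only [Finset.mem_insert, not_or] at hi
        simp [hib, hv i (by simp [hi, hib])]
    obtain ⟨u, hu, huv⟩ := hphase (v b)
    -- The polar angle of `r + i ‖v b‖` splits `‖z‖ e_a` into components of sizes `r` and `‖v b‖`.
    set z : ℂ := ⟨r, ‖v b‖⟩ with hz
    have hc : (‖z‖ : ℂ) * cos z.arg = r := by
      have := Complex.norm_mul_cos_arg z
      exact_mod_cast this
    have hs : (‖z‖ : ℂ) * sin z.arg = ‖v b‖ := by
      have := Complex.norm_mul_sin_arg z
      exact_mod_cast this
    -- The factor `I` cancels the `-I` in the off-diagonal entries of `planeRotation`; `u` is the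
    -- phase of `v b`.
    have hu' : ‖u * I‖ = 1 := by simp [hu]
    have hWb : W *ᵥ Pi.single b 1 = Pi.single b 1 := hWi b (by simp [hb, Ne.symm hab])
    refine ⟨diagonal (Function.update 1 b (u * I)) * W * planeRotation a b z.arg,
      mul_mem (mul_mem (hDu b _ hu') hW) ⟨hR a b hab _, planeRotation_mem_unitaryGroup hab _⟩,
      ‖z‖, norm_nonneg _, ?_, ?_⟩
    · have h1 : planeRotation a b z.arg *ᵥ Pi.single a (‖z‖ : ℂ) =
          Pi.single a (r : ℂ) + (-I * ‖v b‖) • Pi.single b 1 := by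
        rw [planeRotation_mulVec hab]
        ext x
        by_cases hxa : x = a
        · subst hxa; simp [hab, ← hc, mul_comm]
        · by_cases hxb : x = b
          · subst hxb
            simp [hxa, ← hs]; ring
          · simp [hxa, hxb]
      rw [← Matrix.mulVec_mulVec, h1, ← Matrix.mulVec_mulVec, Matrix.mulVec_add,
        Matrix.mulVec_smul, hWv, hWb]
      ext x
      rw [Matrix.mulVec_diagonal]
      by_cases hxb : x = b
      · subst hxb
        simp
        linear_combination huv - u * ‖v x‖ * I_mul_I
      · simp [hxb]
    · intro i hi
      simp only [Finset.mem_insert, not_or] at hi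
      obtain ⟨hia, hib, hiS⟩ := hi
      have h1 : planeRotation a b z.arg *ᵥ Pi.single i 1 = Pi.single i (1 : ℂ) := by
        rw [planeRotation_mulVec hab]
        ext x
        by_cases hxa : x = a
        · subst hxa; simp [Ne.symm hia, Ne.symm hib]
        · by_cases hxb : x = b
          · subst hxb
            simp [hxa, Ne.symm hia, Ne.symm hib]
          · simp [hxa, hxb]
      rw [← Matrix.mulVec_mulVec, h1, ← Matrix.mulVec_mulVec, hWi i (by simp [hia, hiS])]
      ext x
      rw [Matrix.mulVec_diagonal]
      by_cases hx : x = i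
      · subst hx; simp [hib]
      · simp [hx]

/-- Givens elimination: diagonal unitary matrices and plane rotations generate the unitary
group. -/
theorem unitaryGroup_le_of_planeRotation_mem {N : Submonoid (Matrix ι ι ℂ)}
    (hD : ∀ f : ι → ℂ, (∀ i, ‖f i‖ = 1) → diagonal f ∈ N)
    (hR : ∀ p q : ι, p ≠ q → ∀ θ, planeRotation p q θ ∈ N) : unitaryGroup ι ℂ ≤ N := by
  suffices h : ∀ (S : Finset ι) (G : Matrix ι ι ℂ), G ∈ unitaryGroup ι ℂ →
      (∀ i, i ∉ S → G *ᵥ Pi.single i 1 = Pi.single i 1) → G ∈ N from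
    fun G hG => h Finset.univ G hG (by simp)
  intro S
  induction S using Finset.induction_on with
  | empty =>
    intro G _ hG
    have : G = 1 := Matrix.ext_of_mulVec_single fun i => by rw [hG i (by simp), Matrix.one_mulVec]
    rw [this]; exact one_mem N
  | insert a S ha ih =>
    intro G hG hGi
    have hGG : star G * G = 1 := (Matrix.mem_unitaryGroup_iff').1 hG
    -- Column `a` of `G` is orthogonal to the columns `e_i` with `i ∉ insert a S`, so it is
    -- supported in `insert a S`.
    obtain ⟨W, ⟨hWN, hWu⟩, r, hr, hWa, hWi⟩ :=
      exists_mulVec_single_eq hD hR a S ha (G *ᵥ Pi.single a 1) fun i hi => by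
        have h1 := congrFun (congrFun hGG i) a
        have hia : i ≠ a := by rintro rfl; simp at hi
        have h2 : ∀ x, G x i = (Pi.single i 1 : ι → ℂ) x := fun x => by
          rw [← hGi i hi]; simp
        rw [Matrix.mul_apply, Finset.sum_eq_single i] at h1
        · simpa [Matrix.star_apply, h2, hia] using h1
        · intro x _ hx
          simp [Matrix.star_apply, h2, hx]
        · simp
    have hWW : star W * W = 1 := (Matrix.mem_unitaryGroup_iff').1 hWu
    have hWW' : W * star W = 1 := (Matrix.mem_unitaryGroup_iff).1 hWu
    have hG' : star W * G ∈ unitaryGroup ι ℂ := mul_mem (Unitary.star_mem hWu) hG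
    have hcol : (star W * G) *ᵥ Pi.single a 1 = Pi.single a (r : ℂ) := by
      rw [← Matrix.mulVec_mulVec, ← hWa, Matrix.mulVec_mulVec, hWW, Matrix.one_mulVec]
    -- Column `a` of the unitary `star W * G` has norm one, and `0 ≤ r` excludes `-1`.
    have hr1 : r = 1 := by
      have h1 := congrFun (congrFun ((Matrix.mem_unitaryGroup_iff').1 hG') a) a
      have h2 : ∀ x, (star W * G) x a = (Pi.single a (r : ℂ) : ι → ℂ) x := fun x => by
        rw [← hcol]; simp
      rw [Matrix.mul_apply, Finset.sum_eq_single a] at h1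
      · simp only [Matrix.star_apply, h2, Pi.single_eq_same, Matrix.one_apply_eq] at h1
        have h3 : r * r = 1 := by
          simp only [Complex.star_def, Complex.conj_ofReal] at h1
          exact_mod_cast h1
        nlinarith
      · intro x _ hx
        simp [Matrix.star_apply, h2, hx]
      · simp
    -- Only `W` has to lie in `N`; the factor `star W * G` is unitary and fixes one more basis
    -- vector.
    have : G = W * (star W * G) := by rw [← mul_assoc, hWW', one_mul]
    rw [this]
    refine mul_mem hWN (ih _ hG' fun i hi => ?_)
    by_cases hia : i = a
    · subst hia; rw [hcol, hr1, Complex.ofReal_one]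
    · have hi' : i ∉ insert a S := by simp [hia, hi]
      rw [← Matrix.mulVec_mulVec, hGi i hi']
      conv_lhs => rw [← hWi i hi']
      rw [Matrix.mulVec_mulVec, hWW, Matrix.one_mulVec]

end QDot
namespace QDot
open Matrix Complex

/-! ### Diagonal gates -/

section Generation

variable {n : ℕ}

/-- The eigenvalue of `σ_z` on a basis ket. -/
def bitSign (b : Fin 2) : ℝ := if b = 0 then 1 else -1

lemma bitSign_add (a b : Fin 2) : bitSign (a + b) = bitSign a * bitSign b := by
  revert a b
  simp [Fin.forall_fin_two, bitSign]

lemma one_add_bitSign_mul (a b : Fin 2) : 1 + bitSign a * bitSign b = if a = b then 2 else 0 := by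
  revert a b
  norm_num [Fin.forall_fin_two, bitSign]

lemma onQubit_diagonal (j : Fin n) (d : Fin 2 → ℂ) :
    onQubit j (diagonal d) = diagonal fun x : Fin n → Fin 2 => d (x j) := by
  rw [diagonal_eq_multiplexed j, onQubit_eq_multiplexed]
  simp

lemma spinRotation_z (c : ℝ) :
    spinRotation c ![0, 0, 1] = diagonal fun b => exp (I * ((-c * bitSign b : ℝ) : ℂ)) := by
  have h0 : exp (I * c) = cos c + sin c * I := by rw [mul_comm, Complex.exp_mul_I]
  have h1 : exp (-(I * c)) = cos c - sin c * I := by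
    rw [← mul_neg, mul_comm, Complex.exp_mul_I, Complex.cos_neg, Complex.sin_neg]; ring
  ext a b
  fin_cases a <;> fin_cases b <;>
    simp [spinRotation, Fin.sum_univ_three, pauli_two, bitSign, h0, h1]
  · ring
  · ring

/-- The real functions `g` on the basis kets such that all gates `exp (i s g)` belong to `N`. -/
def phaseFunctions (N : Submonoid (Op n)) : Submodule ℝ ((Fin n → Fin 2) → ℝ) where
  carrier := {g | ∀ s : ℝ, diagonal (fun x => exp (I * ((s * g x : ℝ) : ℂ))) ∈ N}
  add_mem' {f g} hf hg s := by
    have : diagonal (fun x => exp (I * ((s * (f + g) x : ℝ) : ℂ))) =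
        diagonal (fun x => exp (I * ((s * f x : ℝ) : ℂ))) *
          diagonal (fun x => exp (I * ((s * g x : ℝ) : ℂ))) := by
      rw [diagonal_mul_diagonal]
      congr 1; ext x
      rw [← Complex.exp_add, Pi.add_apply]
      push_cast
      ring_nf
    rw [this]
    exact mul_mem (hf s) (hg s)
  zero_mem' s := by simp
  smul_mem' c g hg s := by
    convert hg (s * c) using 4 with x
    simp [mul_assoc]

/-- The Hadamard gate. -/
noncomputable def hadamard : Matrix (Fin 2) (Fin 2) ℂ :=
  ∑ a, ((![(√2)⁻¹, 0, (√2)⁻¹] a : ℝ) : ℂ) • pauli a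

lemma sum_hadamard_axis : ∑ a, (![(√2)⁻¹, 0, (√2)⁻¹] : Fin 3 → ℝ) a ^ 2 = 1 := by
  norm_num [Fin.sum_univ_succ]

lemma hadamard_conj_diagonal (d : Fin 2 → ℂ) :
    hadamard * diagonal d * hadamard =
      Matrix.of fun a b => if a = b then (d 0 + d 1) / 2 else (d 0 - d 1) / 2 := by
  have h : ((√2 : ℝ) : ℂ)⁻¹ * ((√2 : ℝ) : ℂ)⁻¹ = 1 / 2 := by
    rw [← mul_inv, ← Complex.ofReal_mul]; norm_num
  ext a b
  fin_cases a <;> fin_cases b <;>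
    simp [hadamard, Fin.sum_univ_three, pauli_zero, pauli_two, Matrix.mul_apply, Matrix.vecMul_diagonal]
  · linear_combination (d 0 + d 1) * h
  · linear_combination (d 0 - d 1) * h
  · linear_combination (d 0 - d 1) * h
  · linear_combination (d 0 + d 1) * h

/-- The controlled not on the basis kets, with control `k` and target `j`. -/
def flipIf (j k : Fin n) (hjk : j ≠ k) : Equiv.Perm (Fin n → Fin 2) :=
  Function.Involutive.toPerm (fun x => Function.update x j (x j + x k)) fun x => by
    have : ∀ a b : Fin 2, a + b + b = a := by decide
    simp [hjk.symm, this]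

lemma flipIf_apply (j k : Fin n) (hjk : j ≠ k) (x : Fin n → Fin 2) :
    flipIf j k hjk x = Function.update x j (x j + x k) := rfl

/-- This is conjugation by a permutation matrix. Requiring `σ⁻¹ = σ` avoids any need for inverses in
`N`. -/
lemma submatrix_mem {ι : Type*} [Fintype ι] [DecidableEq ι] {N : Submonoid (Matrix ι ι ℂ)}
    {σ : Equiv.Perm ι} (hσ : σ⁻¹ = σ) (h : σ.permMatrix ℂ ∈ N) {A : Matrix ι ι ℂ} (hA : A ∈ N) :
    A.submatrix σ σ ∈ N := by
  have : A.submatrix σ σ = σ.permMatrix ℂ * A * σ.permMatrix ℂ := by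
    rw [PEquiv.toMatrix_toPEquiv_mul, PEquiv.mul_toMatrix_toPEquiv, submatrix_submatrix]
    congr 1
    exact (congrArg _ hσ).symm
  rw [this]
  exact mul_mem (mul_mem h hA) h

/-- `N` contains the phases and the gates which the quantum dots provide. -/
structure HasDotGates (N : Submonoid (Op n)) : Prop where
  phase_mem : ∀ c : ℂ, ‖c‖ = 1 → c • (1 : Op n) ∈ N
  spinRotation_mem : ∀ j c v, ∑ a, v a ^ 2 = 1 → onQubit j (spinRotation c v) ∈ N
  exchangeGate_mem : ∀ j k, j < k → ∀ w, 0 ≤ w → onPair j k (exchangeGate w) ∈ N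

namespace HasDotGates

variable {N : Submonoid (Op n)} (hN : HasDotGates N)
include hN

lemma smul_mem {c : ℂ} (hc : ‖c‖ = 1) {G : Op n} (hG : G ∈ N) : c • G ∈ N := by
  simpa using mul_mem (hN.phase_mem c hc) hG

lemma one_mem_phaseFunctions : (fun _ => 1) ∈ phaseFunctions N := fun s => by
  have := hN.phase_mem (exp (I * s)) (by rw [mul_comm]; exact Complex.norm_exp_ofReal_mul_I s)
  rw [← diagonal_one, ← diagonal_smul] at this
  convert this using 3 with x
  simp

lemma bitSign_mem_phaseFunctions (j : Fin n) :
    (fun x => bitSign (x j)) ∈ phaseFunctions N := fun s => by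
  have := hN.spinRotation_mem j (-s) ![0, 0, 1] (by simp [Fin.sum_univ_three])
  simpa [spinRotation_z, onQubit_diagonal] using this

lemma diagonal_bitSign_mem (j : Fin n) :
    diagonal (fun x : Fin n → Fin 2 => (bitSign (x j) : ℂ)) ∈ N := by
  have := hN.smul_mem (c := -I) (by simp) (hN.bitSign_mem_phaseFunctions j (Real.pi / 2))
  rw [← diagonal_smul] at this
  convert this using 2
  ext x
  have h1 : exp (I * (Real.pi / 2)) = I := by
    rw [mul_comm]; exact Complex.exp_pi_div_two_mul_I
  have h2 : exp (-(I * (Real.pi / 2))) = -I := by rw [Complex.exp_neg, h1, Complex.inv_I]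
  simp only [Pi.smul_apply]
  generalize x j = b
  fin_cases b <;> simp [bitSign, h1, h2]

/-- Couplings are nonnegative, but up to a phase the gate is `2π`-periodic in `w`, so negative `w`
can be shifted to nonnegative ones. -/
lemma exchange_mem {j k : Fin n} (hjk : j < k) (w : ℝ) :
    cos w • (1 : Op n) + (-I * sin w) • (exchange j k).permMatrix ℂ ∈ N := by
  obtain ⟨m, hm⟩ := exists_nat_ge (-w / (2 * Real.pi))
  have hw : 0 ≤ w + m * (2 * Real.pi) := by
    rw [div_le_iff₀ Real.two_pi_pos] at hm
    linarith
  have := hN.smul_mem (c := exp ((-((w + m * (2 * Real.pi)) / 2) : ℝ) * I))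
    (Complex.norm_exp_ofReal_mul_I _) (hN.exchangeGate_mem j k hjk _ hw)
  rw [onPair_exchangeGate, smul_smul, ← Complex.exp_add, ← Complex.ofReal_cos,
    ← Complex.ofReal_sin, Real.cos_add_nat_mul_two_pi, Real.sin_add_nat_mul_two_pi,
    onPair_swapGate] at this
  convert this using 1
  rw [show ∀ u : ℝ, ((-(u / 2) : ℝ) : ℂ) * I + I * ((u : ℂ) / 2) = 0 by intro u; push_cast; ring]
  simp

/-- A spin echo: conjugation by `σ_z` on slot `j` reverses the `xx` and `yy` parts of the coupling
and keeps `zz`. Multiplying an exchange gate by its conjugate therefore leaves a pure `zz` phase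
gate. -/
lemma bitSign_mul_bitSign_mem_phaseFunctions {j k : Fin n} (hjk : j < k) :
    (fun x => bitSign (x j) * bitSign (x k)) ∈ phaseFunctions N := fun s => by
  set W : Op n := (exchange j k).permMatrix ℂ with hW
  set D : Op n := diagonal fun x : Fin n → Fin 2 => (bitSign (x j) : ℂ) with hD
  set Q : Op n := diagonal fun x : Fin n → Fin 2 => ((bitSign (x j) * bitSign (x k) : ℝ) : ℂ) with hQ
  have hWW : W * W = 1 := by
    rw [hW, ← onPair_swapGate, onPair_swapGate_mul_self]
  have hWd : ∀ f : (Fin n → Fin 2) → ℂ,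
      W * diagonal f = diagonal (fun x => f (exchange j k x)) * W := by
    intro f
    ext x y
    simp only [hW, mul_diagonal, diagonal_mul, Equiv.Perm.permMatrix, PEquiv.toMatrix_apply,
      Equiv.toPEquiv_apply, Option.mem_some_iff]
    split_ifs with h
    · rw [← h]; ring
    · ring
  have hDD : D * D = 1 := by
    rw [hD, diagonal_mul_diagonal, ← diagonal_one]
    congr 1; ext x
    generalize x j = b
    fin_cases b <;> simp [bitSign]
  have hDWD : D * W * D = Q * W := by
    rw [mul_assoc, hD, hWd, ← mul_assoc, diagonal_mul_diagonal, hQ]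
    simp [exchange_apply]
  have hQW : W * Q = Q * W := by
    rw [hQ, hWd]
    simp [exchange_apply, mul_comm]
  -- `1 + Q` vanishes unless the bits `j` and `k` agree, and the exchange fixes the kets where they
  -- do.
  have hfix : (1 + Q) * W = 1 + Q := by
    have : (1 : Op n) + Q = diagonal fun x : Fin n → Fin 2 => if x j = x k then (2 : ℂ) else 0 := by
      rw [hQ, ← diagonal_one, diagonal_add]
      congr 1; ext x
      have := one_add_bitSign_mul (x j) (x k)
      split_ifs with h
      · rw [if_pos h] at this; exact_mod_cast this
      · rw [if_neg h] at this; exact_mod_cast this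
    rw [this]
    ext x y
    simp only [diagonal_mul, hW, Equiv.Perm.permMatrix, PEquiv.toMatrix_apply,
      Equiv.toPEquiv_apply, Option.mem_some_iff, diagonal_apply]
    split_ifs with h1 h2 h3 h3
    · ring
    · exact absurd (by rw [← h2]; ext1 i; rw [exchange_apply]; rcases eq_or_ne i j with rfl | hj
                       · simp [h1]
                       · rcases eq_or_ne i k with rfl | hk
                         · simp [h1]
                         · rw [Equiv.swap_apply_of_ne_of_ne hj hk]) h3
    · exact absurd (by rw [← h3]; ext1 i; rw [exchange_apply]; rcases eq_or_ne i j with rfl | hj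
                       · simp [h1]
                       · rcases eq_or_ne i k with rfl | hk
                         · simp [h1]
                         · rw [Equiv.swap_apply_of_ne_of_ne hj hk]) h2
    all_goals ring
  have hE := hN.exchange_mem hjk (-s)
  rw [← hW] at hE
  set a : ℂ := cos ((-s : ℝ) : ℂ) with ha
  set b : ℂ := -I * sin ((-s : ℝ) : ℂ) with hb
  have hDm : D ∈ N := hN.diagonal_bitSign_mem j
  have key := mul_mem hE (mul_mem (mul_mem hDm hE) hDm)
  have hcalc : (a • (1 : Op n) + b • W) * (D * (a • (1 : Op n) + b • W) * D) =
      (a + b) • (a • (1 : Op n) + b • Q) := by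
    have h1 : D * (a • (1 : Op n) + b • W) * D = a • (1 : Op n) + b • (Q * W) := by
      simp only [mul_add, add_mul, mul_smul_comm, smul_mul_assoc, mul_one, hDD, hDWD]
    have h2 : W * (Q * W) = Q := by rw [← mul_assoc, hQW, mul_assoc, hWW, mul_one]
    have h3 : W = 1 + Q - Q * W := by
      rw [← hfix, add_mul, one_mul]; abel
    rw [h1]
    simp only [mul_add, add_mul, mul_smul_comm, smul_mul_assoc, mul_one, one_mul, h2]
    nth_rewrite 1 [h3]
    module
  rw [hcalc] at key
  have hab : a + b = exp (s * I) := by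
    rw [Complex.exp_mul_I, ha, hb, Complex.ofReal_neg, Complex.cos_neg, Complex.sin_neg]; ring
  have key2 := hN.smul_mem (c := exp ((-s : ℝ) * I)) (Complex.norm_exp_ofReal_mul_I _) key
  rw [hab, smul_smul, ← Complex.exp_add] at key2
  convert key2 using 1
  rw [show ((-s : ℝ) : ℂ) * I + s * I = 0 by push_cast; ring, Complex.exp_zero, one_smul, hQ,
    ← diagonal_one, ← diagonal_smul, ← diagonal_smul, diagonal_add]
  congr 1; ext x
  have h1 : ∀ ε : ℝ, ε = 1 ∨ ε = -1 →
      exp (I * ((s * ε : ℝ) : ℂ)) = a + b * (ε : ℂ) := by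
    rintro ε (rfl | rfl)
    · rw [Complex.ofReal_one, mul_one, mul_one, hab, mul_comm]
    · rw [mul_comm I, Complex.exp_mul_I, ha, hb]
      simp [mul_comm]
  have h2 : bitSign (x j) * bitSign (x k) = 1 ∨ bitSign (x j) * bitSign (x k) = -1 := by
    generalize x j = b, x k = c
    revert b c
    simp [Fin.forall_fin_two, bitSign]
  rw [h1 _ h2]
  simp

lemma bitSign_mul_bitSign_mem_phaseFunctions_of_ne {j k : Fin n} (hjk : j ≠ k) :
    (fun x => bitSign (x j) * bitSign (x k)) ∈ phaseFunctions N := by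
  rcases lt_or_gt_of_ne hjk with h | h
  · exact hN.bitSign_mul_bitSign_mem_phaseFunctions h
  · simpa only [mul_comm] using hN.bitSign_mul_bitSign_mem_phaseFunctions h

lemma onQubit_hadamard_mem (j : Fin n) : onQubit j hadamard ∈ N := by
  have := hN.smul_mem (c := I) (by simp)
    (hN.spinRotation_mem j (Real.pi / 2) _ sum_hadamard_axis)
  rw [spinRotation, ← hadamard, ← onQubit_smul] at this
  convert this using 2
  push_cast
  rw [Complex.cos_pi_div_two, Complex.sin_pi_div_two, zero_smul, zero_add, smul_smul]
  simp

/-- Gates which on slot `j` act as a combination of `1` and `σ_x`, controlled by the other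
slots. -/
lemma multiplexed_mem (j : Fin n) {f : (Fin n → Fin 2) → ℂ} (hf : diagonal f ∈ N) :
    (multiplexed j fun x => Matrix.of fun a b =>
      if a = b then (f (Function.update x j 0) + f (Function.update x j 1)) / 2
      else (f (Function.update x j 0) - f (Function.update x j 1)) / 2) ∈ N := by
  have := mul_mem (mul_mem (hN.onQubit_hadamard_mem j) hf) (hN.onQubit_hadamard_mem j)
  rw [onQubit_eq_multiplexed, diagonal_eq_multiplexed j, multiplexed_mul, multiplexed_mul] at this
  simpa only [hadamard_conj_diagonal] using this

lemma permMatrix_flipIf_mem {j k : Fin n} (hjk : j ≠ k) :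
    (flipIf j k hjk).permMatrix ℂ ∈ N := by
  -- The indicator is `(1 - z_j)(1 - z_k) / 4`. Its phase gate at angle `π` is controlled-Z, which
  -- Hadamard conjugation on slot `j` turns into CNOT.
  have hV : (fun x => if x j = 1 ∧ x k = 1 then 1 else 0) ∈ phaseFunctions N := by
    have h := (phaseFunctions N).smul_mem (1 / 4) (add_mem (sub_mem (sub_mem
      hN.one_mem_phaseFunctions (hN.bitSign_mem_phaseFunctions j))
      (hN.bitSign_mem_phaseFunctions k)) (hN.bitSign_mul_bitSign_mem_phaseFunctions_of_ne hjk))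
    convert h using 1
    ext x
    simp only [Pi.smul_apply, Pi.add_apply, Pi.sub_apply, smul_eq_mul]
    generalize x j = a, x k = b
    revert a b
    norm_num [Fin.forall_fin_two, bitSign]
  have h := hN.multiplexed_mem j (hV Real.pi)
  convert h using 1
  have hpi : exp (I * Real.pi) = -1 := by rw [mul_comm]; exact Complex.exp_pi_mul_I
  ext x y
  have hiff : Function.update x j (x j + x k) = y ↔
      (∀ i, i ≠ j → x i = y i) ∧ x j + x k = y j := by
    rw [Function.update_eq_iff, and_comm]
  simp only [Equiv.Perm.permMatrix, PEquiv.toMatrix_apply, Equiv.toPEquiv_apply,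
    Option.mem_some_iff, flipIf_apply, multiplexed, Matrix.of_apply, Function.update_self,
    Function.update_of_ne hjk.symm, hiff]
  by_cases h0 : ∀ i, i ≠ j → x i = y i
  · simp only [if_pos h0, and_iff_right h0]
    generalize x j = a, x k = b, y j = c
    revert a b c
    simp [Fin.forall_fin_two, hpi]
  · rw [if_neg (fun h => h0 h.1), if_neg h0]

lemma comp_flipIf_mem_phaseFunctions {j k : Fin n} (hjk : j ≠ k) {g : (Fin n → Fin 2) → ℝ}
    (hg : g ∈ phaseFunctions N) : g ∘ flipIf j k hjk ∈ phaseFunctions N := fun s => by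
  have := submatrix_mem rfl (hN.permMatrix_flipIf_mem hjk) (hg s)
  rwa [submatrix_diagonal_equiv] at this

/-- CNOT replaces `x j` by `x j + x k`, hence `z_j` by `z_j z_k`. With `j ∈ T` and `k ∉ T` this
adjoins `k` to the product, so the induction starts from singletons. -/
lemma prod_bitSign_mem_phaseFunctions (T : Finset (Fin n)) :
    (fun x => ∏ i ∈ T, bitSign (x i)) ∈ phaseFunctions N := by
  rcases T.eq_empty_or_nonempty with rfl | hT
  · simpa using hN.one_mem_phaseFunctions
  induction hT using Finset.Nonempty.cons_induction with
  | singleton j => simpa using hN.bitSign_mem_phaseFunctions j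
  | cons k T hk hT ih =>
    obtain ⟨j, hj⟩ := hT
    have hjk : j ≠ k := by rintro rfl; exact hk hj
    convert hN.comp_flipIf_mem_phaseFunctions hjk ih using 1
    ext x
    rw [Function.comp_apply, flipIf_apply, Finset.prod_cons, ← Finset.mul_prod_erase T _ hj,
      ← Finset.mul_prod_erase T _ hj, Function.update_self, bitSign_add]
    have : ∏ i ∈ T.erase j, bitSign (Function.update x j (x j + x k) i) =
        ∏ i ∈ T.erase j, bitSign (x i) :=
      Finset.prod_congr rfl fun i hi => by
        rw [Function.update_of_ne (Finset.ne_of_mem_erase hi)]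
    rw [this]
    ring

lemma phaseFunctions_eq_top : phaseFunctions N = ⊤ := by
  rw [eq_top_iff]
  intro g _
  have hdelta : ∀ y : Fin n → Fin 2, (Pi.single y 1 : (Fin n → Fin 2) → ℝ) ∈ phaseFunctions N := by
    intro y
    -- Fourier inversion on `(ℤ/2)^n`: the product over `i` of `1 + z_i(x) z_i(y)` is `2 ^ n` if `x
    -- = y` and `0` otherwise.
    have : (Pi.single y 1 : (Fin n → Fin 2) → ℝ) = (1 / 2 ^ n : ℝ) •
        ∑ T ∈ (Finset.univ : Finset (Fin n)).powerset, (∏ i ∈ T, bitSign (y i)) •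
          fun x : Fin n → Fin 2 => ∏ i ∈ T, bitSign (x i) := by
      ext x
      simp only [Pi.smul_apply, Finset.sum_apply, smul_eq_mul, ← Finset.prod_mul_distrib]
      rw [← Finset.prod_one_add]
      simp only [one_add_bitSign_mul]
      by_cases h : x = y
      · subst h; simp
      · obtain ⟨i, hi⟩ := Function.ne_iff.1 h
        rw [Finset.prod_eq_zero (Finset.mem_univ i) (if_neg (Ne.symm hi))]
        simp [h]
    rw [this]
    exact Submodule.smul_mem _ _ (Submodule.sum_mem _ fun T _ =>
      Submodule.smul_mem _ _ (hN.prod_bitSign_mem_phaseFunctions T))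
  rw [pi_eq_sum_univ' g]
  exact Submodule.sum_mem _ fun y _ => Submodule.smul_mem _ _ (hdelta y)

lemma diagonal_mem {f : (Fin n → Fin 2) → ℂ} (hf : ∀ x, ‖f x‖ = 1) : diagonal f ∈ N := by
  have h : (fun x => (f x).arg) ∈ phaseFunctions N := by
    rw [hN.phaseFunctions_eq_top]; trivial
  convert h 1 using 3 with x
  have := Complex.norm_mul_exp_arg_mul_I (f x)
  rw [hf x, Complex.ofReal_one, one_mul, mul_comm] at this
  rw [one_mul, this]

/-! ### Plane rotations -/

lemma planeRotation_flip_mem (x : Fin n → Fin 2) (j : Fin n) (θ : ℝ) :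
    planeRotation x (Function.update x j (x j + 1)) θ ∈ N := by
  -- `f` is `exp (-i θ σ_z)` on slot `j` when the other bits agree with `x`, and `1` elsewhere;
  -- Hadamard conjugation changes `σ_z` into `σ_x`.
  set f : (Fin n → Fin 2) → ℂ := fun z =>
    if ∀ i, i ≠ j → x i = z i then exp (((-θ * bitSign (z j) : ℝ) : ℂ) * I) else 1 with hf
  have h := hN.multiplexed_mem j (hN.diagonal_mem (f := f) fun z => by
    rw [hf]; dsimp only
    split_ifs
    · exact Complex.norm_exp_ofReal_mul_I _
    · simp)
  have h0 := Complex.exp_mul_I (θ : ℂ)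
  have h1 := Complex.exp_mul_I (-θ : ℂ)
  rw [Complex.cos_neg, Complex.sin_neg] at h1
  have hoff : ∀ z b, (∀ i, i ≠ j → x i = Function.update z j b i) ↔ ∀ i, i ≠ j → x i = z i :=
    fun z b => forall_congr' fun i => forall_congr' fun hi => by rw [Function.update_of_ne hi]
  have heq : ∀ z w : Fin n → Fin 2, (∀ i, i ≠ j → z i = w i) → (z = w ↔ z j = w j) :=
    fun z w h => ⟨fun e => e ▸ rfl, fun e => funext fun i =>
      if hi : i = j then hi ▸ e else h i hi⟩
  convert h using 1
  ext z y
  simp only [planeRotation, multiplexed, Matrix.of_apply, hf, Function.update_idem, hoff,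
    Function.update_self]
  by_cases hzy : ∀ i, i ≠ j → z i = y i
  · rw [if_pos hzy]
    by_cases hxz : ∀ i, i ≠ j → x i = z i
    · have hxy : ∀ i, i ≠ j → x i = y i := fun i hi => (hxz i hi).trans (hzy i hi)
      simp only [if_pos hxz]
      simp only [heq z y hzy]
      have hz : z = x ↔ z j = x j := heq z x fun i hi => (hxz i hi).symm
      have hy : y = x ↔ y j = x j := heq y x fun i hi => (hxy i hi).symm
      have hz' : z = Function.update x j (x j + 1) ↔ z j = x j + 1 := by
        rw [heq z _ fun i hi => by rw [Function.update_of_ne hi, hxz i hi], Function.update_self]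
      have hy' : y = Function.update x j (x j + 1) ↔ y j = x j + 1 := by
        rw [heq y _ fun i hi => by rw [Function.update_of_ne hi, hxy i hi], Function.update_self]
      simp only [hz, hy, hz', hy']
      simp only [bitSign]
      generalize x j = a, z j = b, y j = c
      have e1 : (exp (-(θ : ℂ) * I) + exp (θ * I)) / 2 = cos θ := by rw [h0, h1]; ring
      have e2 : (exp (-(θ : ℂ) * I) - exp (θ * I)) / 2 = -I * sin θ := by rw [h0, h1]; ring
      revert a b c
      simp only [Fin.forall_fin_two]
      simp [e1, e2, -neg_mul]
    · have hz1 : z ≠ x := by rintro rfl; exact hxz fun _ _ => rfl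
      have hz2 : z ≠ Function.update x j (x j + 1) := by
        rintro rfl; exact hxz fun i hi => by rw [Function.update_of_ne hi]
      simp only [if_neg hxz, hz1, hz2, false_and, or_false, if_false]
      simp only [heq z y hzy]
      norm_num
  · rw [if_neg hzy]
    have hz : z ≠ y := by rintro rfl; exact hzy fun _ _ => rfl
    rw [if_neg hz, if_neg]
    rintro (⟨rfl, rfl⟩ | ⟨rfl, rfl⟩)
    · exact hzy fun i hi => by rw [Function.update_of_ne hi]
    · exact hzy fun i hi => by rw [Function.update_of_ne hi]

/-! ### Transpositions of basis kets and the full unitary group. -/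

lemma permMatrix_swap_flip_mem (x : Fin n → Fin 2) (j : Fin n) :
    (Equiv.swap x (Function.update x j (x j + 1))).permMatrix ℂ ∈ N := by
  set y := Function.update x j (x j + 1) with hy
  have hxy : x ≠ y := fun h => by
    have h1 := congrFun h j
    rw [hy, Function.update_self] at h1
    revert h1
    generalize x j = b
    revert b
    decide
  -- At angle `π / 2` the rotation is `-i σ_x` in this plane, and the diagonal factor removes `-i`.
  have h1 := mul_mem (hN.planeRotation_flip_mem x j (Real.pi / 2))
    (hN.diagonal_mem (f := fun z => if z = x ∨ z = y then I else 1) fun z => by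
      split_ifs <;> simp)
  convert h1 using 1
  rw [← hy]
  ext z w
  simp only [mul_diagonal, planeRotation, Matrix.of_apply, Equiv.Perm.permMatrix,
    PEquiv.toMatrix_apply, Equiv.toPEquiv_apply, Option.mem_some_iff]
  push_cast
  rw [Complex.cos_pi_div_two, Complex.sin_pi_div_two, mul_one]
  rcases eq_or_ne z x with rfl | hzx
  · rw [Equiv.swap_apply_left]
    rcases eq_or_ne w y with rfl | hwy
    · simp [hxy]
    · simp [hwy, hwy.symm, hxy]
  · rcases eq_or_ne z y with rfl | hzy
    · rw [Equiv.swap_apply_right]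
      rcases eq_or_ne w x with rfl | hwx
      · simp [hzx]
      · simp [hwx, hwx.symm, hzx]
    · rw [Equiv.swap_apply_of_ne_of_ne hzx hzy]
      rcases eq_or_ne z w with rfl | hzw
      · simp [hzx, hzy]
      · simp [hzx, hzy, hzw]

/-- The bits of `x` are changed into those of `y` one at a time, through the kets `s.piecewise y x`;
transpositions along this path compose to the one of its endpoints. -/
lemma permMatrix_swap_mem (x y : Fin n → Fin 2) : (Equiv.swap x y).permMatrix ℂ ∈ N := by
  suffices h : ∀ s : Finset (Fin n),
      Equiv.swap x (s.piecewise y x) ∈ N.comap (Matrix.permMatrixHom (R := ℂ)) by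
    simpa using h Finset.univ
  intro s
  induction s using Finset.induction_on with
  | empty =>
    rw [Finset.piecewise_empty, Equiv.swap_self]
    exact one_mem _
  | insert j s hj ih =>
    refine SubmonoidClass.swap_mem_trans _ ih ?_
    rw [Finset.piecewise_insert]
    have hxj : s.piecewise y x j = x j := by simp [hj]
    have hflip : ∀ a b : Fin 2, b = a ∨ b = a + 1 := by decide
    rcases hflip (x j) (y j) with h | h
    · rw [h, ← hxj, Function.update_eq_self, Equiv.swap_self]
      exact one_mem _
    · have := hN.permMatrix_swap_flip_mem (s.piecewise y x) j
      rw [h, ← hxj]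
      simpa [Submonoid.mem_comap] using this

theorem unitaryGroup_le (hn : 0 < n) : unitaryGroup (Fin n → Fin 2) ℂ ≤ N := by
  refine unitaryGroup_le_of_planeRotation_mem (fun f hf => hN.diagonal_mem hf)
    fun p q hpq θ => ?_
  let j : Fin n := ⟨0, hn⟩
  set p' := Function.update p j (p j + 1) with hp'
  have hpp' : p ≠ p' := fun h => by
    have h1 := congrFun h j
    rw [hp', Function.update_self] at h1
    revert h1
    generalize p j = b
    revert b
    decide
  -- Conjugation by the transposition of `q` and `p'` fixes `p` and moves the plane of `p, p'` to
  -- that of `p, q`.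
  have h := submatrix_mem (σ := Equiv.swap q p') (Equiv.swap_inv _ _)
    (hN.permMatrix_swap_mem q p') (hN.planeRotation_flip_mem p j θ)
  rw [← planeRotation_submatrix p q θ (Equiv.swap q p'), Equiv.swap_apply_left,
    Equiv.swap_apply_of_ne_of_ne hpq hpp']
  exact h

end HasDotGates

end Generation

end QDot
namespace QDot
open Matrix Complex

/-! ### Universality -/

/-- The operators which belong to `M` up to a phase factor. -/
def upToPhase {n : ℕ} (M : Submonoid (Op n)) : Submonoid (Op n) where
  carrier := {G | MemUpToPhase G M}
  one_mem' := ⟨1, by simp, by simp⟩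
  mul_mem' := by
    rintro A B ⟨c, hc, hA⟩ ⟨d, hd, hB⟩
    refine ⟨c * d, by simp [hc, hd], ?_⟩
    rw [← smul_mul_smul_comm]
    exact mul_mem hA hB

lemma hasDotGates_upToPhase {n : ℕ} {M : Submonoid (Op n)}
    (h1 : ∀ j c v, ∑ a, v a ^ 2 = 1 → onQubit j (spinRotation c v) ∈ M)
    (h2 : ∀ j k, j < k → ∀ w, 0 ≤ w → onPair j k (exchangeGate w) ∈ M) :
    HasDotGates (upToPhase M) where
  phase_mem c hc := ⟨c⁻¹, by simp [hc], by
    rw [smul_smul, inv_mul_cancel₀ (by rintro rfl; simp at hc), one_smul]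
    exact one_mem M⟩
  spinRotation_mem j c v hv := ⟨1, by simp, by rw [one_smul]; exact h1 j c v hv⟩
  exchangeGate_mem j k hjk w hw := ⟨1, by simp, by rw [one_smul]; exact h2 j k hjk w hw⟩

lemma hasDotGates_pulseGates {ħ : ℝ} (hħ : 0 < ħ) (n : ℕ) :
    HasDotGates (upToPhase (Submonoid.closure (pulseGates ħ n))) :=
  hasDotGates_upToPhase
    (fun j c _ hv => Submonoid.subset_closure (onQubit_spinRotation_mem_pulseGates hħ j c hv))
    (fun _ _ hjk _ hw => Submonoid.subset_closure (onPair_exchangeGate_mem_pulseGates hħ hjk hw))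

lemma hasDotGates_circuits {ħ : ℝ} (hħ : 0 < ħ) (n : ℕ) :
    HasDotGates (upToPhase (circuits (oneDotGates ħ) (pulseGates ħ 2) n)) :=
  hasDotGates_upToPhase
    (fun j c v hv => Submonoid.subset_closure
      (Or.inl ⟨j, _, onQubit_spinRotation_mem_pulseGates hħ 0 c hv, rfl⟩))
    (fun j k hjk w hw => Submonoid.subset_closure
      (Or.inr ⟨j, k, hjk.ne, _, by
        rw [← onPair_zero_one (exchangeGate w)]
        exact onPair_exchangeGate_mem_pulseGates hħ (by decide) hw, rfl⟩))

lemma rotGate_eq_spinRotation (θ φ : ℝ) :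
    rotGate θ φ = spinRotation θ ![Real.cos φ, Real.sin φ, 0] := by
  have h0 : exp (I * φ) = cos φ + sin φ * I := by rw [mul_comm, Complex.exp_mul_I]
  have h1 : exp (-(I * φ)) = cos φ - sin φ * I := by
    rw [← mul_neg, mul_comm, Complex.exp_mul_I, Complex.cos_neg, Complex.sin_neg]; ring
  ext a b
  fin_cases a <;> fin_cases b <;>
    simp [rotGate, spinRotation, Fin.sum_univ_three, pauli_zero, pauli_one, pauli_two, h0, h1]
  · ring
  · ring

lemma cnot_eq_permMatrix : cnot = (flipIf 1 0 (by decide)).permMatrix ℂ := by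
  ext x y
  have hiff : Function.update x 1 (x 1 + x 0) = y ↔ x 0 = y 0 ∧ x 1 + x 0 = y 1 := by
    rw [funext_iff, Fin.forall_fin_two]
    simp
  simp only [cnot, controlled, pauli_zero, Matrix.of_apply, Equiv.Perm.permMatrix,
    PEquiv.toMatrix_apply, Equiv.toPEquiv_apply, Option.mem_some_iff, flipIf_apply, hiff]
  generalize x 0 = a, x 1 = b, y 0 = c, y 1 = d
  revert a b c d
  simp [Fin.forall_fin_two]

end QDot

theorem theorem5p6 (ħ : ℝ) (hħ : 0 < ħ) :
    (∀ θ ∈ Set.Icc (0 : ℝ) (2 * Real.pi), ∀ φ ∈ Set.Icc (0 : ℝ) (2 * Real.pi),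
      QDot.rotGate θ φ ∈ QDot.oneDotGates ħ ∧
        ∀ j : Fin 2, QDot.onQubit j (QDot.rotGate θ φ) ∈ QDot.pulseGates ħ 2) ∧
    QDot.MemUpToPhase (QDot.phaseGate Real.pi) (Submonoid.closure (QDot.pulseGates ħ 2)) ∧
    QDot.MemUpToPhase QDot.cnot (Submonoid.closure (QDot.pulseGates ħ 2)) ∧
    QDot.Universal (QDot.oneDotGates ħ) (QDot.pulseGates ħ 2) ∧
    (∀ n : ℕ, 2 ≤ n → ∀ G ∈ Matrix.unitaryGroup (Fin n → Fin 2) ℂ,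
      QDot.MemUpToPhase G (Submonoid.closure (QDot.pulseGates ħ n))) := by
  refine ⟨fun θ _ φ _ => ?_, ?_, ?_, fun n hn G hG => ?_, fun n hn G hG => ?_⟩
  · have h : ∑ a, (![Real.cos φ, Real.sin φ, 0] : Fin 3 → ℝ) a ^ 2 = 1 := by
      simp [Fin.sum_univ_three]
    rw [QDot.rotGate_eq_spinRotation]
    exact ⟨QDot.onQubit_spinRotation_mem_pulseGates hħ 0 θ h,
      fun j => QDot.onQubit_spinRotation_mem_pulseGates hħ j θ h⟩
  · refine (QDot.hasDotGates_pulseGates hħ 2).diagonal_mem fun x => ?_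
    split_ifs
    · rw [mul_comm]; exact Complex.norm_exp_ofReal_mul_I _
    · simp
  · rw [QDot.cnot_eq_permMatrix]
    exact (QDot.hasDotGates_pulseGates hħ 2).permMatrix_flipIf_mem _
  · exact (QDot.hasDotGates_circuits hħ n).unitaryGroup_le (by omega) hG
  · exact (QDot.hasDotGates_pulseGates hħ n).unitaryGroup_le (by omega) hG
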